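/- Let $(\Omega,P)$ be a probability space (for instance an interval $I\subseteq\mathbb R$ with the measure $dF$ of a distribution function $F$), and let $a:\Omega\to\mathbb R$ be a measurable profit function that is not almost everywhere constant and is essentially bounded below. Put $$\xi=\operatorname{ess\,inf}a,\qquad E=\int a\,dP\in(-\infty,\infty],\qquad H_\xi=\int\frac{dP}{a-\xi}\in(0,\infty],$$ where $H_\xi=\infty$ if $P(a=\xi)>0$, and $1/\infty=0$. Let $\Psi(c)=1/\int(a+c)^{-1}dP-c$ for $c>-\xi$, and let $\rho$ be the measure on $(0,\infty)$ with $\int_0^\infty\frac{\rho(dt)}{t(t+1)}<\infty$ and $$\Psi(c)=\xi+\frac1{H_\xi}+\int_0^\infty\frac{c+\xi}{t(t+c+\xi)}\,\rho(dt)\qquad(c>-\xi).$$ For a game with profit function $b$ and a price $u>0$, call $t$ admissible if $0\le t\le1$ and $t\,\operatorname{ess\,inf}b/u-t+1>0$. An optimal proportion of investment at the price $u$ is a limit $t_u$ of admissible proportions such that $$\limsup_{\substack{r\to t_u\\ r\text{ admissible}}}\int\log\frac{b\,s/u-s+1}{b\,r/u-r+1}\,dP\le0\qquad\text{for every admissible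 }s.$$ For a real number $m<E$ consider the translated game with profit function $a-m$; its expectation is $\underline E=E-m$. Write $\underline t_u$ for its optimal proportion at the price $u$, and $\underline u_{\max}\in(0,\underline E)$ for the price such that $\underline t_u$ is strictly increasing for $0<u<\underline u_{\max}$, strictly decreasing for $\underline u_{\max}<u<\underline E$, and maximal at $u=\underline u_{\max}$. **Theorem 3.19.** If $\int_0^\infty\rho(dt)<\infty$, then $E<\infty$; for all $m<E$ sufficiently close to $E$ the proportions $\underline t_u$ $(0<u<\underline E)$ and the price $\underline u_{\max}$ exist and are unique; and $$\lim_{m\to E^-}\frac{\underline u_{\max}}{\underline E}=\frac12 .$$ -/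

import Mathlib

open MeasureTheory Filter Set
open scoped Topology ENNReal

noncomputable section

namespace InvestmentGame

/-- The integral of a real function with values in the extended reals,
`∫ f⁺ - ∫ f⁻`.  It agrees with the Bochner integral when `f` is integrable. -/
def extIntegral {Ω : Type*} [MeasurableSpace Ω] (P : Measure Ω) (f : Ω → ℝ) : EReal :=
  ((∫⁻ x, ENNReal.ofReal (f x) ∂P : ℝ≥0∞) : EReal) -
    ((∫⁻ x, ENNReal.ofReal (-f x) ∂P : ℝ≥0∞) : EReal)

/-- The expectation `E = ∫ a dP`, possibly infinite. -/
def mean {Ω : Type*} [MeasurableSpace Ω] (P : Measure Ω) (a : Ω → ℝ) : EReal :=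
  extIntegral P a

/-- `ξ = ess inf a`. -/
def xi {Ω : Type*} [MeasurableSpace Ω] (P : Measure Ω) (a : Ω → ℝ) : ℝ :=
  essInf a P

/-- `H = ∫ 1 / (a - ξ) dP` in `[0, ∞]`.  The inverse is taken in `[0, ∞]`, so `1 / 0 = ∞`
and `H = ∞` as soon as `a = ξ` has positive probability. -/
def H {Ω : Type*} [MeasurableSpace Ω] (P : Measure Ω) (a : Ω → ℝ) : ℝ≥0∞ :=
  ∫⁻ x, (ENNReal.ofReal (a x - xi P a))⁻¹ ∂P

/-- `Ψ(c) = 1 / ∫ (a + c)⁻¹ dP - c`, used for `c > -ξ`, where the integrand is positive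
and bounded. -/
def Psi {Ω : Type*} [MeasurableSpace Ω] (P : Measure Ω) (a : Ω → ℝ) (c : ℝ) : ℝ :=
  1 / (∫ x, (a x + c)⁻¹ ∂P) - c

/-- `ρ`, regarded as a measure on `(0, ∞)`, is the representing measure of `Ψ`:
`∫ 1 / (t (t + 1)) ρ(dt) < ∞` and, for all `c > -ξ`,
`Ψ(c) = ξ + 1 / H + ∫ (c + ξ) / (t (t + c + ξ)) ρ(dt)`, with `1 / ∞ = 0`. -/
def IsRepresentingMeasure {Ω : Type*} [MeasurableSpace Ω] (P : Measure Ω) (a : Ω → ℝ)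
    (ρ : Measure ℝ) : Prop :=
  IntegrableOn (fun t : ℝ => 1 / (t * (t + 1))) (Ioi 0) ρ ∧
  ∀ c : ℝ, -xi P a < c →
    Psi P a c = xi P a + ((H P a)⁻¹).toReal +
      ∫ t in Ioi (0 : ℝ), (c + xi P a) / (t * (t + c + xi P a)) ∂ρ

/-- The proportions `t ∈ [0, 1]` with `ξ t / u - t + 1 > 0`, for the price `u`. -/
def admissible {Ω : Type*} [MeasurableSpace Ω] (P : Measure Ω) (a : Ω → ℝ) (u : ℝ) : Set ℝ :=
  {t | 0 ≤ t ∧ t ≤ 1 ∧ 0 < xi P a * t / u - t + 1}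

/-- `t` is an optimal proportion of investment at the price `u`: it is a limit of admissible
proportions, and for every admissible `s` the upper limit of
`∫ log ((a s / u - s + 1) / (a r / u - r + 1)) dP`, as `r → t` through admissible
proportions, is at most `0`. -/
def IsOptimalProportion {Ω : Type*} [MeasurableSpace Ω] (P : Measure Ω) (a : Ω → ℝ)
    (u t : ℝ) : Prop :=
  t ∈ closure (admissible P a u) ∧
  ∀ s ∈ admissible P a u,
    limsup (fun r : ℝ => extIntegral P
      (fun x => Real.log ((a x * s / u - s + 1) / (a x * r / u - r + 1))))
      (𝓝[admissible P a u] t) ≤ 0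

/-- `v` is the price `u_max` of the game `a`: on the price range `0 < u < E` the optimal
proportion `t u` is strictly increasing before `v`, strictly decreasing after `v`, and maximal
at `v`. -/
def IsMaxPrice {Ω : Type*} [MeasurableSpace Ω] (P : Measure Ω) (a : Ω → ℝ) (v : ℝ) : Prop :=
  0 < v ∧ (v : EReal) < mean P a ∧
  ∃ t : ℝ → ℝ,
    (∀ u : ℝ, 0 < u → (u : EReal) < mean P a → IsOptimalProportion P a u (t u)) ∧
    StrictMonoOn t (Ioo 0 v) ∧
    StrictAntiOn t {u : ℝ | v < u ∧ (u : EReal) < mean P a} ∧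
    ∀ u : ℝ, 0 < u → (u : EReal) < mean P a → t u ≤ t v

end InvestmentGame

end

noncomputable section

namespace InvestmentGame

/-! Let `ν` be `ρ` restricted to `(0, ∞)`, finite by hypothesis, with Stieltjes transform `S` and
`T(y,z) = ∫ ν(dt) / ((t + y)(t + z))`. Splitting the kernel of `Ψ` into `1/t - 1/(t + z)`, `z = c +
ξ`, and letting `z → ∞` gives `E < ∞` and `1 / ∫ (a - ξ + z)⁻¹ dP = z + E - ξ - S(z)`
(`integrable_of_representing`).

In the translated game put `e = E - m`, `k = m - ξ`. The first order condition at the price `u = e -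
S(y)` is solved by `u / (u + c)` with `c = y + k` (`optimal_translated`, `isOptimalProportion_iff`).
So `y` parametrizes the prices, and the proportion rises or falls with `(e - S(y)) / (y + k)`. That
ratio has a single peak, where `S(y) + (y + k) T(y,y) = e` (`strictMonoOn_ratio`,
`strictAntiOn_ratio`).

At the peak, `u_max / e = (y + k) T / (S + (y + k) T)`. As `e → 0` the peak moves to infinity, where
`y S(y)` and `y² T(y,y)` both tend to the total mass of `ν`; the two terms of the denominator
balance and the limit is `1/2` (`tendsto_critical_ratio`). -/

/-- The Stieltjes transform `∫ 1 / (t + y) ν(dt)`. -/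
def stieltjes (ν : Measure ℝ) (y : ℝ) : ℝ := ∫ t, (t + y)⁻¹ ∂ν

/-- The negative of the divided difference of the Stieltjes transform,
`∫ 1 / ((t + y) (t + z)) ν(dt)`. -/
def stieltjesDiff (ν : Measure ℝ) (y z : ℝ) : ℝ := ∫ t, (t + y)⁻¹ * (t + z)⁻¹ ∂ν

lemma stieltjesDiff_comm {ν : Measure ℝ} (y z : ℝ) : stieltjesDiff ν y z = stieltjesDiff ν z y := by
  simp only [stieltjesDiff, mul_comm]

/-! ### Stieltjes transforms of finite measures on the positive half-line. -/

section Stieltjes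

variable {ν : Measure ℝ} [IsFiniteMeasure ν]

lemma integrable_of_ae_bound {f : ℝ → ℝ} (hf : Measurable f) (C : ℝ)
    (h : ∀ᵐ t ∂ν, 0 ≤ f t ∧ f t ≤ C) : Integrable f ν := by
  refine Integrable.of_bound hf.aestronglyMeasurable C ?_
  filter_upwards [h] with t ht
  rw [Real.norm_of_nonneg ht.1]
  exact ht.2

lemma integrable_inv_add (hν : ∀ᵐ t ∂ν, 0 < t) {y : ℝ} (hy : 0 < y) :
    Integrable (fun t => (t + y)⁻¹) ν := by
  refine integrable_of_ae_bound (by fun_prop) y⁻¹ ?_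
  filter_upwards [hν] with t ht
  exact ⟨by positivity, inv_anti₀ hy (by linarith)⟩

lemma integrable_inv_add_mul (hν : ∀ᵐ t ∂ν, 0 < t) {y z : ℝ} (hy : 0 < y) (hz : 0 < z) :
    Integrable (fun t => (t + y)⁻¹ * (t + z)⁻¹) ν := by
  refine integrable_of_ae_bound (by fun_prop) (y⁻¹ * z⁻¹) ?_
  filter_upwards [hν] with t ht
  have h1 : (t + y)⁻¹ ≤ y⁻¹ := inv_anti₀ hy (by linarith)
  have h2 : (t + z)⁻¹ ≤ z⁻¹ := inv_anti₀ hz (by linarith)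
  exact ⟨by positivity, by gcongr⟩

lemma integral_pos_of_ae_pos {α : Type*} [MeasurableSpace α] {μ : Measure α} (hμ : μ ≠ 0)
    {f : α → ℝ} (hf : Integrable f μ) (h : ∀ᵐ t ∂μ, 0 < f t) : 0 < ∫ t, f t ∂μ := by
  have : NeZero μ := ⟨hμ⟩
  refine lt_of_le_of_ne (integral_nonneg_of_ae (h.mono fun t ht => ht.le)) fun h0 => ?_
  have h1 := (integral_eq_zero_iff_of_nonneg_ae (h.mono fun t ht => ht.le) hf).1 h0.symm
  obtain ⟨t, ht, ht'⟩ := (h.and h1).exists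
  exact ht.ne' ht'

lemma stieltjes_pos (hν : ∀ᵐ t ∂ν, 0 < t) (h0 : ν ≠ 0) {y : ℝ} (hy : 0 < y) :
    0 < stieltjes ν y :=
  integral_pos_of_ae_pos h0 (integrable_inv_add hν hy) (hν.mono fun t ht => by positivity)

lemma stieltjesDiff_pos (hν : ∀ᵐ t ∂ν, 0 < t) (h0 : ν ≠ 0) {y z : ℝ} (hy : 0 < y)
    (hz : 0 < z) : 0 < stieltjesDiff ν y z :=
  integral_pos_of_ae_pos h0 (integrable_inv_add_mul hν hy hz)
    (hν.mono fun t ht => by positivity)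

/-- Partial fractions under the integral. This replaces differentiation in all the monotonicity
arguments. -/
lemma stieltjes_sub (hν : ∀ᵐ t ∂ν, 0 < t) {y z : ℝ} (hy : 0 < y) (hz : 0 < z) :
    stieltjes ν y - stieltjes ν z = (z - y) * stieltjesDiff ν y z := by
  unfold stieltjes stieltjesDiff
  rw [← integral_sub (integrable_inv_add hν hy) (integrable_inv_add hν hz),
    ← integral_const_mul]
  refine integral_congr_ae ?_
  filter_upwards [hν] with t ht
  field_simp
  ring

lemma stieltjes_strictAnti (hν : ∀ᵐ t ∂ν, 0 < t) (h0 : ν ≠ 0) :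
    StrictAntiOn (stieltjes ν) (Ioi 0) := by
  intro y hy z hz hyz
  have h := stieltjes_sub hν hy hz
  have := mul_pos (sub_pos.2 hyz) (stieltjesDiff_pos hν h0 hy hz)
  linarith

lemma stieltjesDiff_lt (hν : ∀ᵐ t ∂ν, 0 < t) (h0 : ν ≠ 0) {x y z : ℝ} (hx : 0 < x) (hy : 0 < y)
    (hyz : y < z) : stieltjesDiff ν x z < stieltjesDiff ν x y := by
  have hz := hy.trans hyz
  have h1 := integrable_inv_add_mul hν hx hy
  have h2 := integrable_inv_add_mul hν hx hz
  have : 0 < ∫ t, ((t + x)⁻¹ * (t + y)⁻¹ - (t + x)⁻¹ * (t + z)⁻¹) ∂ν := by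
    refine integral_pos_of_ae_pos h0 (h1.sub h2) ?_
    filter_upwards [hν] with t ht
    have : (t + z)⁻¹ < (t + y)⁻¹ := inv_strictAnti₀ (by linarith) (by linarith)
    have : (t + x)⁻¹ * (t + z)⁻¹ < (t + x)⁻¹ * (t + y)⁻¹ := by gcongr
    linarith
  rw [integral_sub h1 h2] at this
  unfold stieltjesDiff
  linarith

lemma continuousOn_stieltjes (hν : ∀ᵐ t ∂ν, 0 < t) : ContinuousOn (stieltjes ν) (Ioi 0) := by
  intro x hx
  refine ContinuousAt.continuousWithinAt ?_
  have hx : 0 < x := hx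
  refine continuousAt_of_dominated (bound := fun _ => (x / 2)⁻¹) ?_ ?_ (integrable_const _) ?_
  · exact Eventually.of_forall fun y =>
      (by fun_prop : Measurable fun t : ℝ => (t + y)⁻¹).aestronglyMeasurable
  · filter_upwards [lt_mem_nhds (half_lt_self hx)] with y hy
    filter_upwards [hν] with t ht
    have : 0 < y := (half_pos hx).trans hy
    rw [Real.norm_of_nonneg (by positivity)]
    exact inv_anti₀ (by positivity) (by linarith)
  · filter_upwards [hν] with t ht
    have : t + x ≠ 0 := by positivity
    fun_prop (disch := assumption)

lemma continuousOn_stieltjesDiff_diag (hν : ∀ᵐ t ∂ν, 0 < t) :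
    ContinuousOn (fun y => stieltjesDiff ν y y) (Ioi 0) := by
  intro x hx
  refine ContinuousAt.continuousWithinAt ?_
  have hx : 0 < x := hx
  refine continuousAt_of_dominated (bound := fun _ => (x / 2)⁻¹ * (x / 2)⁻¹) ?_ ?_
    (integrable_const _) ?_
  · exact Eventually.of_forall fun y =>
      (by fun_prop : Measurable fun t : ℝ => (t + y)⁻¹ * (t + y)⁻¹).aestronglyMeasurable
  · filter_upwards [lt_mem_nhds (half_lt_self hx)] with y hy
    filter_upwards [hν] with t ht
    have : 0 < y := (half_pos hx).trans hy
    rw [Real.norm_of_nonneg (by positivity)]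
    have : (t + y)⁻¹ ≤ (x / 2)⁻¹ := inv_anti₀ (by positivity) (by linarith)
    gcongr
  · filter_upwards [hν] with t ht
    have : t + x ≠ 0 := by positivity
    fun_prop (disch := assumption)

lemma tendsto_div_add_atTop (t : ℝ) : Tendsto (fun y : ℝ => y * (t + y)⁻¹) atTop (𝓝 1) := by
  have h : Tendsto (fun y : ℝ => 1 - t * (t + y)⁻¹) atTop (𝓝 (1 - t * 0)) :=
    (tendsto_inv_atTop_zero.comp (tendsto_atTop_add_const_left _ t tendsto_id)).const_mul t
      |>.const_sub 1
  rw [mul_zero, sub_zero] at h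
  refine h.congr' ?_
  filter_upwards [eventually_gt_atTop (-t)] with y hy
  have : t + y ≠ 0 := by linarith
  field_simp
  ring

/-- Finiteness of `ν` makes the constant `1` an integrable dominating function. The limit agrees
with that of `tendsto_sq_mul_stieltjesDiff`, which is the source of the value `1/2`. -/
lemma tendsto_mul_stieltjes (hν : ∀ᵐ t ∂ν, 0 < t) :
    Tendsto (fun y => y * stieltjes ν y) atTop (𝓝 (ν.real univ)) := by
  have h : Tendsto (fun y => ∫ t, y * (t + y)⁻¹ ∂ν) atTop (𝓝 (∫ _, (1 : ℝ) ∂ν)) := by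
    refine tendsto_integral_filter_of_dominated_convergence (fun _ => 1) ?_ ?_
      (integrable_const _) (Eventually.of_forall tendsto_div_add_atTop)
    · exact Eventually.of_forall fun y =>
        (by fun_prop : Measurable fun t : ℝ => y * (t + y)⁻¹).aestronglyMeasurable
    · filter_upwards [eventually_gt_atTop 0] with y hy
      filter_upwards [hν] with t ht
      rw [Real.norm_of_nonneg (by positivity), ← div_eq_mul_inv]
      exact div_le_one_of_le₀ (by linarith) (by positivity)
  simpa only [stieltjes, stieltjesDiff, integral_const_mul, integral_const, smul_eq_mul,
    mul_one] using h

lemma tendsto_sq_mul_stieltjesDiff (hν : ∀ᵐ t ∂ν, 0 < t) :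
    Tendsto (fun y => y ^ 2 * stieltjesDiff ν y y) atTop (𝓝 (ν.real univ)) := by
  have h : Tendsto (fun y => ∫ t, y ^ 2 * ((t + y)⁻¹ * (t + y)⁻¹) ∂ν) atTop
      (𝓝 (∫ _, (1 : ℝ) ∂ν)) := by
    refine tendsto_integral_filter_of_dominated_convergence (fun _ => 1) ?_ ?_
      (integrable_const _) (Eventually.of_forall fun t => ?_)
    · exact Eventually.of_forall fun y =>
        (by fun_prop :
          Measurable fun t : ℝ => y ^ 2 * ((t + y)⁻¹ * (t + y)⁻¹)).aestronglyMeasurable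
    · filter_upwards [eventually_gt_atTop 0] with y hy
      filter_upwards [hν] with t ht
      have : y * (t + y)⁻¹ ≤ 1 := by
        rw [← div_eq_mul_inv]
        exact div_le_one_of_le₀ (by linarith) (by positivity)
      rw [Real.norm_of_nonneg (by positivity)]
      calc y ^ 2 * ((t + y)⁻¹ * (t + y)⁻¹) = (y * (t + y)⁻¹) * (y * (t + y)⁻¹) := by ring
        _ ≤ 1 := mul_le_one₀ this (by positivity) this
    · have := (tendsto_div_add_atTop t).mul (tendsto_div_add_atTop t)
      rw [one_mul] at this
      exact this.congr fun y => by ring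
  simpa only [stieltjes, stieltjesDiff, integral_const_mul, integral_const, smul_eq_mul,
    mul_one] using h

lemma tendsto_stieltjes_zero (hν : ∀ᵐ t ∂ν, 0 < t) :
    Tendsto (stieltjes ν) atTop (𝓝 0) := by
  have h := tendsto_inv_atTop_zero.mul (tendsto_mul_stieltjes hν)
  rw [zero_mul] at h
  refine h.congr' ?_
  filter_upwards [eventually_gt_atTop 0] with y hy
  field_simp

lemma exists_stieltjes_eq (hν : ∀ᵐ t ∂ν, 0 < t) {w : ℝ} (hw : 0 < w)
    (hw1 : w < stieltjes ν 1) : ∃ y, 1 < y ∧ stieltjes ν y = w := by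
  obtain ⟨Y, hY, hY1⟩ := (((tendsto_stieltjes_zero hν).eventually_lt_const hw).and
    (eventually_gt_atTop 1)).exists
  obtain ⟨y, hy, hyw⟩ := intermediate_value_Ioo' hY1.le
    ((continuousOn_stieltjes hν).mono fun z hz => zero_lt_one.trans_le hz.1) ⟨hY, hw1⟩
  exact ⟨y, hy.1, hyw⟩

/-- The critical point of `(e - S y) / (y + k)`, where `S` is the Stieltjes transform. -/
lemma exists_critical (hν : ∀ᵐ t ∂ν, 0 < t) (h0 : ν ≠ 0) {e k : ℝ} (he : 0 < e)
    (he1 : e < stieltjes ν 1) (hk : 0 < k) :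
    ∃ y, 0 < y ∧ stieltjes ν y + (y + k) * stieltjesDiff ν y y = e := by
  obtain ⟨y₀, hy₀, hS⟩ := exists_stieltjes_eq hν he he1
  have hlim : Tendsto (fun y => stieltjes ν y + (y + k) * stieltjesDiff ν y y) atTop (𝓝 0) := by
    have h1 := tendsto_sq_mul_stieltjesDiff hν
    have h2 := (tendsto_inv_atTop_zero (𝕜 := ℝ)).mul h1
    have h3 := ((tendsto_inv_atTop_zero (𝕜 := ℝ)).mul h2).const_mul k
    have h4 := (tendsto_stieltjes_zero hν).add (h2.add h3)
    simp only [zero_mul, mul_zero, add_zero] at h4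
    refine h4.congr' ?_
    filter_upwards [eventually_gt_atTop 0] with y hy
    field_simp
  obtain ⟨Y, hY, hY1⟩ := ((hlim.eventually_lt_const he).and (eventually_gt_atTop y₀)).exists
  have hc : ContinuousOn (fun y => stieltjes ν y + (y + k) * stieltjesDiff ν y y) (Icc y₀ Y) := by
    have hs : Icc y₀ Y ⊆ Ioi 0 := fun z hz => (zero_lt_one.trans hy₀).trans_le hz.1
    exact ((continuousOn_stieltjes hν).mono hs).add
      ((continuousOn_id.add continuousOn_const).mul
        ((continuousOn_stieltjesDiff_diag hν).mono hs))
  have hlow : e < stieltjes ν y₀ + (y₀ + k) * stieltjesDiff ν y₀ y₀ := by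
    have := stieltjesDiff_pos hν h0 (zero_lt_one.trans hy₀) (zero_lt_one.trans hy₀)
    rw [hS]
    have : 0 < (y₀ + k) * stieltjesDiff ν y₀ y₀ := by positivity
    linarith
  obtain ⟨y, hy, hye⟩ := intermediate_value_Ioo' hY1.le hc ⟨hY, hlow⟩
  exact ⟨y, (zero_lt_one.trans hy₀).trans hy.1, hye⟩

/-- Cross-multiplied difference of `(e - S y) / (y + k)` at two points. -/
lemma stieltjes_cross (hν : ∀ᵐ t ∂ν, 0 < t) {e k y z : ℝ} (hy : 0 < y) (hz : 0 < z) :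
    (e - stieltjes ν z) * (y + k) - (e - stieltjes ν y) * (z + k) =
      (z - y) * (stieltjes ν y + (y + k) * stieltjesDiff ν y z - e) := by
  have h := stieltjes_sub hν hy hz
  have : stieltjes ν z = stieltjes ν y - (z - y) * stieltjesDiff ν y z := by linarith
  rw [this]
  ring

lemma stieltjes_slope_lt (hν : ∀ᵐ t ∂ν, 0 < t) (h0 : ν ≠ 0) {k x y z : ℝ} (hk : 0 < k)
    (hx : 0 < x) (hy : 0 < y) (hyz : y < z) :
    stieltjes ν x + (x + k) * stieltjesDiff ν x z <
      stieltjes ν x + (x + k) * stieltjesDiff ν x y := by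
  have := stieltjesDiff_lt hν h0 hx hy hyz
  gcongr

/-- Both sides are `∫ (t + y + z + k) / ((t + y)(t + z)) ν(dt)`. Symmetry lets `stieltjes_slope_lt`
be applied in either argument. -/
lemma stieltjes_slope_symm (hν : ∀ᵐ t ∂ν, 0 < t) {k y z : ℝ} (hy : 0 < y) (hz : 0 < z) :
    stieltjes ν y + (y + k) * stieltjesDiff ν y z =
      stieltjes ν z + (z + k) * stieltjesDiff ν z y := by
  have h := stieltjes_sub hν hy hz
  rw [stieltjesDiff_comm z y]
  linear_combination h

/-- By `stieltjes_cross` the sign of the increment is that of the slope at `(y, z)` minus `e`. The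
slope strictly decreases in each argument and equals `e` at `(x, x)`, so it exceeds `e` when `y < z
≤ x`. -/
lemma strictMonoOn_ratio (hν : ∀ᵐ t ∂ν, 0 < t) (h0 : ν ≠ 0) {e k x : ℝ} (hk : 0 < k)
    (hx : stieltjes ν x + (x + k) * stieltjesDiff ν x x = e) :
    StrictMonoOn (fun y => (e - stieltjes ν y) / (y + k)) (Ioc 0 x) := by
  intro y hy z hz hyz
  have hx0 := hy.1.trans_le hy.2
  have h1 : stieltjes ν x + (x + k) * stieltjesDiff ν x x <
      stieltjes ν y + (y + k) * stieltjesDiff ν y z := by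
    calc _ < stieltjes ν x + (x + k) * stieltjesDiff ν x y :=
          stieltjes_slope_lt hν h0 hk hx0 hy.1 (hyz.trans_le hz.2)
      _ = stieltjes ν y + (y + k) * stieltjesDiff ν y x := stieltjes_slope_symm hν hx0 hy.1
      _ ≤ _ := by
        rcases hz.2.eq_or_lt with rfl | h
        · exact le_rfl
        · exact (stieltjes_slope_lt hν h0 hk hy.1 hz.1 h).le
  have h2 := stieltjes_cross (e := e) (k := k) hν hy.1 hz.1
  have h3 := mul_pos (sub_pos.2 hyz) (sub_pos.2 (hx ▸ h1))
  have hy1 := hy.1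
  have hz1 := hz.1
  rw [div_lt_div_iff₀ (by positivity) (by positivity)]
  linarith

lemma strictAntiOn_ratio (hν : ∀ᵐ t ∂ν, 0 < t) (h0 : ν ≠ 0) {e k x : ℝ} (hk : 0 < k)
    (hx0 : 0 < x) (hx : stieltjes ν x + (x + k) * stieltjesDiff ν x x = e) :
    StrictAntiOn (fun y => (e - stieltjes ν y) / (y + k)) (Ici x) := by
  intro y hy z hz hyz
  have hy0 : 0 < y := hx0.trans_le hy
  have hz0 : 0 < z := hx0.trans_le hz
  have h1 : stieltjes ν y + (y + k) * stieltjesDiff ν y z <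
      stieltjes ν x + (x + k) * stieltjesDiff ν x x := by
    calc _ < stieltjes ν y + (y + k) * stieltjesDiff ν y x :=
          stieltjes_slope_lt hν h0 hk hy0 hx0 (hy.trans_lt hyz)
      _ = stieltjes ν x + (x + k) * stieltjesDiff ν x y := stieltjes_slope_symm hν hy0 hx0
      _ ≤ _ := by
        rcases (show x ≤ y from hy).eq_or_lt with rfl | h
        · exact le_rfl
        · exact (stieltjes_slope_lt hν h0 hk hx0 hx0 h).le
  have h2 := stieltjes_cross (e := e) (k := k) hν hy0 hz0
  have h3 := mul_neg_of_pos_of_neg (sub_pos.2 hyz) (sub_neg.2 (hx ▸ h1))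
  rw [div_lt_div_iff₀ (by positivity) (by positivity)]
  linarith

end Stieltjes

/-! ### Growth rates and the characterization of optimal proportions. -/

section Game

variable {Ω : Type*} [MeasurableSpace Ω] {P : Measure Ω}

lemma extIntegral_eq_integral {f : Ω → ℝ} (hf : Integrable f P) :
    extIntegral P f = ((∫ x, f x ∂P : ℝ) : EReal) := by
  have h1 : ∫⁻ x, ENNReal.ofReal (f x) ∂P ≠ ⊤ := hf.lintegral_lt_top.ne
  have h2 : ∫⁻ x, ENNReal.ofReal (-f x) ∂P ≠ ⊤ := hf.neg.lintegral_lt_top.ne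
  rw [integral_eq_lintegral_pos_part_sub_lintegral_neg_part hf, extIntegral, EReal.coe_sub,
    EReal.coe_ennreal_toReal h1, EReal.coe_ennreal_toReal h2]

/-- The logarithmic growth rate of the proportion `s` at the price `u`. -/
def growth (P : Measure Ω) (b : Ω → ℝ) (u s : ℝ) : ℝ :=
  ∫ x, Real.log (b x * s / u - s + 1) ∂P

lemma integrable_log_of_le [IsFiniteMeasure P] {f : Ω → ℝ} (hf : Integrable f P) {δ : ℝ}
    (hδ : 0 < δ) (h : ∀ᵐ x ∂P, δ ≤ f x) : Integrable (fun x => Real.log (f x)) P := by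
  refine Integrable.mono' (hf.abs.add (integrable_const |Real.log δ|))
    (Real.measurable_log.comp_aemeasurable hf.aemeasurable).aestronglyMeasurable ?_
  filter_upwards [h] with x hx
  have h1 := Real.log_le_sub_one_of_pos (hδ.trans_le hx)
  have h2 := Real.log_le_log hδ hx
  have h3 := le_abs_self (f x)
  have h4 := neg_abs_le (Real.log δ)
  have h5 := abs_nonneg (Real.log δ)
  have h6 := abs_nonneg (f x)
  rw [Real.norm_eq_abs, abs_le]
  constructor <;> simp only [Pi.add_apply] <;> linarith

lemma wealth_lower {b : Ω → ℝ} {u s : ℝ} (hu : 0 < u) (hs : 0 ≤ s)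
    (hb : ∀ᵐ x ∂P, xi P b ≤ b x) :
    ∀ᵐ x ∂P, xi P b * s / u - s + 1 ≤ b x * s / u - s + 1 := by
  filter_upwards [hb] with x hx
  gcongr

lemma integrable_wealth [IsFiniteMeasure P] {b : Ω → ℝ} (hb : Integrable b P) (u s : ℝ) :
    Integrable (fun x => b x * s / u - s + 1) P :=
  (((hb.mul_const s).div_const u).sub (integrable_const s)).add (integrable_const 1)

lemma integrable_log_wealth [IsFiniteMeasure P] {b : Ω → ℝ} (hb : Integrable b P)
    (hxi : ∀ᵐ x ∂P, xi P b ≤ b x) {u s : ℝ} (hu : 0 < u) (hs : s ∈ admissible P b u) :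
    Integrable (fun x => Real.log (b x * s / u - s + 1)) P :=
  integrable_log_of_le (integrable_wealth hb u s) hs.2.2 (wealth_lower hu hs.1 hxi)

/-- For admissible proportions both logarithms are integrable, which turns the optimality criterion
into a comparison of growth rates. -/
lemma extIntegral_log_ratio [IsFiniteMeasure P] {b : Ω → ℝ} (hb : Integrable b P)
    (hxi : ∀ᵐ x ∂P, xi P b ≤ b x) {u s r : ℝ} (hu : 0 < u) (hs : s ∈ admissible P b u)
    (hr : r ∈ admissible P b u) :
    extIntegral P (fun x => Real.log ((b x * s / u - s + 1) / (b x * r / u - r + 1))) =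
      ((growth P b u s - growth P b u r : ℝ) : EReal) := by
  have h1 := integrable_log_wealth hb hxi hu hs
  have h2 := integrable_log_wealth hb hxi hu hr
  have h : (fun x => Real.log (b x * s / u - s + 1) - Real.log (b x * r / u - r + 1)) =ᵐ[P]
      fun x => Real.log ((b x * s / u - s + 1) / (b x * r / u - r + 1)) := by
    filter_upwards [wealth_lower hu hs.1 hxi, wealth_lower hu hr.1 hxi] with x hx1 hx2
    rw [Real.log_div (hs.2.2.trans_le hx1).ne' (hr.2.2.trans_le hx2).ne']
  rw [extIntegral_eq_integral ((h1.sub h2).congr h), ← integral_congr_ae h, integral_sub h1 h2]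
  rfl

lemma convex_admissible (b : Ω → ℝ) (u : ℝ) : Convex ℝ (admissible P b u) := by
  intro s hs r hr p q hp hq hpq
  obtain ⟨hs0, hs1, hs2⟩ := hs
  obtain ⟨hr0, hr1, hr2⟩ := hr
  simp only [smul_eq_mul]
  refine ⟨by positivity, by nlinarith, ?_⟩
  have h : xi P b * (p * s + q * r) / u - (p * s + q * r) + 1 =
      p * (xi P b * s / u - s + 1) + q * (xi P b * r / u - r + 1) := by
    linear_combination (-1 : ℝ) * hpq
  rw [h]
  rcases hp.eq_or_lt with rfl | hp'
  · rw [zero_add] at hpq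
    subst hpq
    linarith
  · have := mul_pos hp' hs2
    have := mul_nonneg hq hr2.le
    linarith

lemma concaveOn_growth [IsFiniteMeasure P] {b : Ω → ℝ} (hb : Integrable b P)
    (hxi : ∀ᵐ x ∂P, xi P b ≤ b x) {u : ℝ} (hu : 0 < u) :
    ConcaveOn ℝ (admissible P b u) (growth P b u) := by
  refine ⟨convex_admissible b u, fun s hs r hr p q hp hq hpq => ?_⟩
  have hm := convex_admissible b u hs hr hp hq hpq
  have h1 := integrable_log_wealth hb hxi hu hs
  have h2 := integrable_log_wealth hb hxi hu hr
  simp only [smul_eq_mul] at hm ⊢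
  unfold growth
  rw [← integral_const_mul, ← integral_const_mul,
    ← integral_add (h1.const_mul p) (h2.const_mul q)]
  refine integral_mono_ae ((h1.const_mul p).add (h2.const_mul q))
    (integrable_log_wealth hb hxi hu hm) ?_
  filter_upwards [wealth_lower hu hs.1 hxi, wealth_lower hu hr.1 hxi] with x hx1 hx2
  have h := strictConcaveOn_log_Ioi.concaveOn.2 (hs.2.2.trans_le hx1) (hr.2.2.trans_le hx2)
    hp hq hpq
  simp only [smul_eq_mul] at h
  refine h.trans_eq (congrArg Real.log ?_)
  linear_combination hpq

lemma mem_interior_admissible {b : Ω → ℝ} {u c : ℝ} (hu : 0 < u) (hneg : xi P b < 0)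
    (hc : -xi P b < c) : u / (u + c) ∈ interior (admissible P b u) := by
  have hc0 : 0 < c := by linarith
  refine mem_interior.2 ⟨{t | 0 < t ∧ t < 1 ∧ 0 < xi P b * t / u - t + 1},
    fun t ht => ⟨ht.1.le, ht.2.1.le, ht.2.2⟩, ?_, by positivity, ?_, ?_⟩
  · exact (isOpen_lt continuous_const continuous_id).inter
      ((isOpen_lt continuous_id continuous_const).inter
        (isOpen_lt continuous_const
          ((((continuous_const.mul continuous_id).div_const u).sub continuous_id).add
            continuous_const)))
  · rw [div_lt_one (by positivity)]
    linarith
  · have : xi P b * (u / (u + c)) / u - u / (u + c) + 1 = (xi P b + c) / (u + c) := by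
      field_simp
      ring
    rw [this]
    have : 0 < xi P b + c := by linarith
    positivity

lemma integrable_inv_of_le [IsFiniteMeasure P] {f : Ω → ℝ} (hf : AEMeasurable f P) {δ : ℝ}
    (hδ : 0 < δ) (h : ∀ᵐ x ∂P, δ ≤ f x) : Integrable (fun x => (f x)⁻¹) P := by
  refine Integrable.of_bound hf.inv.aestronglyMeasurable δ⁻¹ ?_
  filter_upwards [h] with x hx
  rw [Real.norm_of_nonneg (inv_nonneg.2 (hδ.le.trans hx))]
  exact inv_anti₀ hδ hx

/-- The first order condition `(u + c) ∫ (b + c)⁻¹ dP = 1` makes `u / (u + c)` the strict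
maximizer of the growth rate. -/
lemma growth_lt [IsProbabilityMeasure P] {b : Ω → ℝ} (hb : Integrable b P)
    (hxi : ∀ᵐ x ∂P, xi P b ≤ b x) (hnc : ¬ ∃ k : ℝ, ∀ᵐ x ∂P, b x = k) (hneg : xi P b < 0)
    {u c : ℝ} (hu : 0 < u) (hc : -xi P b < c) (hcrit : (u + c) * ∫ x, (b x + c)⁻¹ ∂P = 1)
    {s : ℝ} (hs : s ∈ admissible P b u) (hne : s ≠ u / (u + c)) :
    growth P b u s < growth P b u (u / (u + c)) := by
  have hc0 : 0 < c := by linarith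
  have ht := interior_subset (mem_interior_admissible hu hneg hc)
  set t := u / (u + c) with htdef
  -- The wealth at `t` is `(b + c) / (u + c)`, so the wealth ratio of `s` to `t` is `q + (1 - q)(u +
  -- c) / (b + c)`. Its mean is `1` by the first order condition, and `log r ≤ r - 1` then gives the
  -- weak inequality.
  set q := s * (u + c) / u with hq
  have hq1 : q ≠ 1 := by
    intro h
    apply hne
    rw [hq, div_eq_one_iff_eq hu.ne'] at h
    rw [htdef, eq_div_iff (by positivity)]
    exact h
  have hδ : 0 < xi P b + c := by linarith
  have hbc : ∀ᵐ x ∂P, xi P b + c ≤ b x + c := by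
    filter_upwards [hxi] with x hx
    linarith
  have hinv : Integrable (fun x => (b x + c)⁻¹) P :=
    integrable_inv_of_le (hb.aemeasurable.add_const c) hδ hbc
  have hR : Integrable (fun x => q + (1 - q) * ((u + c) * (b x + c)⁻¹)) P :=
    (integrable_const q).add ((hinv.const_mul (u + c)).const_mul (1 - q))
  have hRint : ∫ x, (q + (1 - q) * ((u + c) * (b x + c)⁻¹)) ∂P = 1 := by
    rw [integral_add (integrable_const q) ((hinv.const_mul (u + c)).const_mul (1 - q)),
      integral_const_mul, integral_const_mul, hcrit]
    simp
  have h1 := integrable_log_wealth hb hxi hu hs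
  have h2 := integrable_log_wealth hb hxi hu ht
  have hratio : ∀ᵐ x ∂P, 0 < q + (1 - q) * ((u + c) * (b x + c)⁻¹) ∧
      Real.log (b x * s / u - s + 1) - Real.log (b x * t / u - t + 1) =
        Real.log (q + (1 - q) * ((u + c) * (b x + c)⁻¹)) := by
    filter_upwards [wealth_lower hu hs.1 hxi, wealth_lower hu ht.1 hxi, hbc] with x hx1 hx2 hx3
    have p1 := hs.2.2.trans_le hx1
    have p2 := ht.2.2.trans_le hx2
    have p3 := hδ.trans_le hx3
    have : q + (1 - q) * ((u + c) * (b x + c)⁻¹) =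
        (b x * s / u - s + 1) / (b x * t / u - t + 1) := by
      rw [eq_div_iff p2.ne', hq, htdef]
      field_simp
      ring
    rw [this, Real.log_div p1.ne' p2.ne']
    exact ⟨div_pos p1 p2, rfl⟩
  have hgap : Integrable (fun x => q + (1 - q) * ((u + c) * (b x + c)⁻¹) - 1 -
      (Real.log (b x * s / u - s + 1) - Real.log (b x * t / u - t + 1))) P :=
    (hR.sub (integrable_const 1)).sub (h1.sub h2)
  have hgap0 : 0 ≤ᵐ[P] fun x => q + (1 - q) * ((u + c) * (b x + c)⁻¹) - 1 -
      (Real.log (b x * s / u - s + 1) - Real.log (b x * t / u - t + 1)) := by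
    filter_upwards [hratio] with x hx
    have := Real.log_le_sub_one_of_pos hx.1
    simp only [Pi.zero_apply]
    rw [hx.2]
    linarith
  have hval : ∫ x, (q + (1 - q) * ((u + c) * (b x + c)⁻¹) - 1 -
      (Real.log (b x * s / u - s + 1) - Real.log (b x * t / u - t + 1))) ∂P =
      growth P b u t - growth P b u s := by
    have e1 := integral_sub (hR.sub (integrable_const 1)) (h1.sub h2)
    have e2 := integral_sub hR (integrable_const (1 : ℝ))
    have e3 := integral_sub h1 h2
    simp only [Pi.sub_apply] at e1
    rw [e1, e2, e3, hRint]
    simp [growth]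
  have hnonneg := integral_nonneg_of_ae hgap0
  rw [hval] at hnonneg
  -- Equality forces `log r = r - 1`, hence ratio `1`, almost everywhere; as `q ≠ 1` this makes `b =
  -- u` almost everywhere.
  refine lt_of_le_of_ne (sub_nonneg.1 hnonneg) fun heq => hnc ⟨u, ?_⟩
  have hz := (integral_eq_zero_iff_of_nonneg_ae hgap0 hgap).1 (by rw [hval, heq, sub_self])
  filter_upwards [hz, hratio, hbc] with x hx hx1 hx2
  have p3 := hδ.trans_le hx2
  simp only [Pi.zero_apply] at hx
  rw [hx1.2] at hx
  have hone : q + (1 - q) * ((u + c) * (b x + c)⁻¹) = 1 := by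
    by_contra hne1
    have := Real.log_lt_sub_one_of_pos hx1.1 hne1
    linarith
  have h3 : (1 - q) * ((u + c) * (b x + c)⁻¹ - 1) = 0 := by linear_combination hone
  have h4 := (mul_eq_zero.1 h3).resolve_left (sub_ne_zero.2 hq1.symm)
  have h5 : (u + c) / (b x + c) = 1 := by
    rw [div_eq_mul_inv]
    linarith
  rw [div_eq_one_iff_eq p3.ne'] at h5
  linarith

/-- The maximizer is interior, where the concave growth rate is continuous, so there the upper limit
is an ordinary limit. Any other limit point, possibly an inadmissible endpoint, is excluded by
concavity. -/
theorem isOptimalProportion_iff [IsProbabilityMeasure P] {b : Ω → ℝ} (hb : Integrable b P)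
    (hxi : ∀ᵐ x ∂P, xi P b ≤ b x) (hnc : ¬ ∃ k : ℝ, ∀ᵐ x ∂P, b x = k) (hneg : xi P b < 0)
    {u c : ℝ} (hu : 0 < u) (hc : -xi P b < c) (hcrit : (u + c) * ∫ x, (b x + c)⁻¹ ∂P = 1)
    {t : ℝ} : IsOptimalProportion P b u t ↔ t = u / (u + c) := by
  have hint := mem_interior_admissible hu hneg hc
  have hadm := interior_subset hint
  have hmax : ∀ s ∈ admissible P b u, s ≠ u / (u + c) →
      growth P b u s < growth P b u (u / (u + c)) :=
    fun s hs => growth_lt hb hxi hnc hneg hu hc hcrit hs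
  have hconc := concaveOn_growth hb hxi hu
  set w := u / (u + c)
  constructor
  · rintro ⟨hcl, hopt⟩
    by_contra hne
    have hbot : (𝓝[admissible P b u] t).NeBot := mem_closure_iff_nhdsWithin_neBot.1 hcl
    have hmid : (1 / 2 : ℝ) • w + (1 / 2 : ℝ) • t ∈ interior (admissible P b u) :=
      hconc.1.combo_interior_closure_mem_interior hint hcl (by norm_num) (by norm_num)
        (by norm_num)
    simp only [smul_eq_mul] at hmid
    -- The midpoint is admissible even if `t` is not. For `r` near `t` it lies between `w` and `r`,
    -- so concavity bounds the growth at `r` by that at `z`, keeping a fixed gap below the maximum.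
    set z := 1 / 2 * w + 1 / 2 * t with hz
    have hzw : z ≠ w := fun h => hne (by linarith)
    have hlt := hmax z (interior_subset hmid) hzw
    have hev : ∀ᶠ r in 𝓝[admissible P b u] t, z ∈ segment ℝ w r := by
      refine eventually_nhdsWithin_of_eventually_nhds ?_
      rcases lt_or_gt_of_ne hne with h | h
      · filter_upwards [gt_mem_nhds (show t < z by linarith)] with r hr
        rw [segment_symm, segment_eq_Icc (by linarith)]
        exact ⟨hr.le, by linarith⟩
      · filter_upwards [lt_mem_nhds (show z < t by linarith)] with r hr
        rw [segment_eq_Icc (by linarith)]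
        exact ⟨by linarith, hr.le⟩
    have hge : ((growth P b u w - growth P b u z : ℝ) : EReal) ≤
        limsup (fun r : ℝ => extIntegral P
          (fun x => Real.log ((b x * w / u - w + 1) / (b x * r / u - r + 1))))
          (𝓝[admissible P b u] t) := by
      refine le_limsup_of_frequently_le' (Eventually.frequently ?_)
      filter_upwards [hev, self_mem_nhdsWithin] with r hr hradm
      rw [extIntegral_log_ratio hb hxi hu hadm hradm, EReal.coe_le_coe_iff]
      have := hconc.ge_on_segment hadm hradm hr
      rcases min_le_iff.1 this with h | h <;> linarith
    have := EReal.coe_nonpos.1 (hge.trans (hopt w hadm))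
    linarith
  · rintro rfl
    have hbot : (𝓝[admissible P b u] w).NeBot :=
      mem_closure_iff_nhdsWithin_neBot.1 (subset_closure hadm)
    refine ⟨subset_closure hadm, fun s hs => ?_⟩
    have hcont : ContinuousAt (growth P b u) w :=
      hconc.continuousOn_interior.continuousAt (isOpen_interior.mem_nhds hint)
    have hlim : Tendsto (fun r : ℝ => extIntegral P
        (fun x => Real.log ((b x * s / u - s + 1) / (b x * r / u - r + 1))))
        (𝓝[admissible P b u] w) (𝓝 ((growth P b u s - growth P b u w : ℝ) : EReal)) := by
      refine ((continuous_coe_real_ereal.tendsto _).comp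
        ((hcont.tendsto.mono_left nhdsWithin_le_nhds).const_sub (growth P b u s))).congr' ?_
      filter_upwards [self_mem_nhdsWithin] with r hr
      exact (extIntegral_log_ratio hb hxi hu hs hr).symm
    rw [hlim.limsup_eq, EReal.coe_nonpos, sub_nonpos]
    rcases eq_or_ne s w with rfl | h
    · exact le_rfl
    · exact (hmax s hs h).le

end Game

/-! ### The essential infimum and translation. -/

section EssInf

variable {Ω : Type*} [MeasurableSpace Ω] {P : Measure Ω}

lemma xi_le {a : Ω → ℝ} (hbdd : ∃ B : ℝ, ∀ᵐ x ∂P, B ≤ a x) : ∀ᵐ x ∂P, xi P a ≤ a x := by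
  obtain ⟨B, hB⟩ := hbdd
  exact ae_essInf_le ⟨B, hB⟩

lemma le_xi [NeZero P] {a : Ω → ℝ} {B : ℝ} (hB : ∀ᵐ x ∂P, B ≤ a x) : B ≤ xi P a := by
  -- The real-valued `essInf` is meaningful only with coboundedness; this holds because a real
  -- function cannot exceed every natural number on a set of full nonzero measure.
  have hfreq : ∃ n : ℕ, ∃ᶠ x in ae P, a x ≤ n := by
    by_contra hcon
    simp only [not_exists, not_frequently, not_le] at hcon
    obtain ⟨x, hx⟩ := (ae_all_iff.2 hcon).exists
    obtain ⟨n, hn⟩ := exists_nat_gt (a x)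
    exact (hx n).not_gt hn
  obtain ⟨n, hn⟩ := hfreq
  exact le_essInf_of_ae_le B hB (IsCoboundedUnder.of_frequently_le hn)

lemma xi_sub [NeZero P] {a : Ω → ℝ} (hbdd : ∃ B : ℝ, ∀ᵐ x ∂P, B ≤ a x) (m : ℝ) :
    xi P (fun x => a x - m) = xi P a - m := by
  have h1 : ∀ᵐ x ∂P, xi P a - m ≤ a x - m := (xi_le hbdd).mono fun x hx => by linarith
  have h2 := xi_le ⟨_, h1⟩
  have h3 : xi P (fun x => a x - m) + m ≤ xi P a := le_xi (h2.mono fun x hx => by linarith)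
  have h4 := le_xi h1
  linarith

end EssInf

/-! ### Shifted harmonic means and their limit, the arithmetic mean. -/

section HarmonicMean

variable {Ω : Type*} [MeasurableSpace Ω] {P : Measure Ω} {f : Ω → ℝ}

lemma integrable_inv_add_const [IsProbabilityMeasure P]
    (hf : AEMeasurable f P) (h0 : ∀ᵐ x ∂P, 0 ≤ f x) {z : ℝ}
    (hz : 0 < z) : Integrable (fun x => (f x + z)⁻¹) P :=
  integrable_inv_of_le (hf.add_const z) hz (h0.mono fun x hx => by linarith)

lemma integral_inv_add_pos [IsProbabilityMeasure P]
    (hf : AEMeasurable f P) (h0 : ∀ᵐ x ∂P, 0 ≤ f x) {z : ℝ}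
    (hz : 0 < z) : 0 < ∫ x, (f x + z)⁻¹ ∂P :=
  integral_pos_of_ae_pos (IsProbabilityMeasure.ne_zero P) (integrable_inv_add_const hf h0 hz)
    (h0.mono fun x hx => by positivity)

lemma mul_div_add_eq (h0 : ∀ᵐ x ∂P, 0 ≤ f x) {z : ℝ} (hz : 0 < z) :
    (fun x => z - z ^ 2 * (f x + z)⁻¹) =ᵐ[P] fun x => z * f x / (f x + z) := by
  filter_upwards [h0] with x hx
  have : 0 < f x + z := by positivity
  field_simp
  ring

lemma integrable_mul_div_add [IsProbabilityMeasure P]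
    (hf : AEMeasurable f P) (h0 : ∀ᵐ x ∂P, 0 ≤ f x) {z : ℝ}
    (hz : 0 < z) : Integrable (fun x => z * f x / (f x + z)) P :=
  ((integrable_const z).sub ((integrable_inv_add_const hf h0 hz).const_mul (z ^ 2))).congr
    (mul_div_add_eq h0 hz)

lemma integral_mul_div_add [IsProbabilityMeasure P]
    (hf : AEMeasurable f P) (h0 : ∀ᵐ x ∂P, 0 ≤ f x) {z : ℝ}
    (hz : 0 < z) :
    ∫ x, z * f x / (f x + z) ∂P = z - z ^ 2 * ∫ x, (f x + z)⁻¹ ∂P := by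
  rw [← integral_congr_ae (mul_div_add_eq h0 hz), integral_sub (integrable_const z)
    ((integrable_inv_add_const hf h0 hz).const_mul (z ^ 2)), integral_const_mul]
  simp

lemma tendsto_mul_div_add (w : ℝ) : Tendsto (fun z : ℝ => z * w / (w + z)) atTop (𝓝 w) := by
  have h := (tendsto_div_add_atTop w).const_mul w
  rw [mul_one] at h
  exact h.congr fun z => by ring

/-- With `I = ∫ (f + z)⁻¹ dP`, the mean of `z f / (f + z)` is `(1/I - z) · zI`, at most `K` since
`zI ≤ 1`. These functions tend to `f`, so Fatou's lemma along `z = n + 1` bounds the integral of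
`f`. -/
lemma integrable_of_harmonic_bounded [IsProbabilityMeasure P]
    (hf : AEMeasurable f P) (h0 : ∀ᵐ x ∂P, 0 ≤ f x) {K : ℝ}
    (hK : ∀ z, 0 < z → 1 / (∫ x, (f x + z)⁻¹ ∂P) - z ≤ K) : Integrable f P := by
  have hbound : ∀ z : ℝ, 0 < z → ∫ x, z * f x / (f x + z) ∂P ≤ K := by
    intro z hz
    have hI := integral_inv_add_pos hf h0 hz
    have hnn : 0 ≤ ∫ x, z * f x / (f x + z) ∂P :=
      integral_nonneg_of_ae (h0.mono fun x hx => by simp only [Pi.zero_apply]; positivity)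
    have hKz := hK z hz
    rw [integral_mul_div_add hf h0 hz] at hnn ⊢
    set I := ∫ x, (f x + z)⁻¹ ∂P
    have h1 : z * I ≤ 1 := by
      have : 0 ≤ z * (1 - z * I) := by linarith
      have := nonneg_of_mul_nonneg_right this hz
      linarith
    have h2 : 0 ≤ 1 / I - z := by
      rw [sub_nonneg, le_div_iff₀ hI]
      exact h1
    calc z - z ^ 2 * I = (1 / I - z) * (z * I) := by
          field_simp
      _ ≤ (1 / I - z) * 1 := by gcongr
      _ ≤ K := by linarith
  refine ⟨hf.aestronglyMeasurable, ?_⟩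
  have hcongr : ∫⁻ x, ‖f x‖ₑ ∂P = ∫⁻ x, liminf (fun n : ℕ =>
      ENNReal.ofReal (((n : ℝ) + 1) * f x / (f x + ((n : ℝ) + 1)))) atTop ∂P := by
    refine lintegral_congr_ae ?_
    filter_upwards [h0] with x hx
    have ht : Tendsto (fun n : ℕ => ((n : ℝ) + 1) * f x / (f x + ((n : ℝ) + 1))) atTop
        (𝓝 (f x)) :=
      (tendsto_mul_div_add (f x)).comp
        (tendsto_atTop_add_const_right _ 1 tendsto_natCast_atTop_atTop)
    rw [(ENNReal.tendsto_ofReal ht).liminf_eq, Real.enorm_of_nonneg hx]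
  rw [HasFiniteIntegral, hcongr]
  refine (lintegral_liminf_le' fun n => ?_).trans_lt ?_
  · exact (((hf.const_mul _).div (hf.add_const _))).ennreal_ofReal
  · refine (liminf_le_of_frequently_le' (x := ENNReal.ofReal K) (Frequently.of_forall ?_)).trans_lt
      ENNReal.ofReal_lt_top
    intro n
    have hn : (0 : ℝ) < n + 1 := by positivity
    rw [← ofReal_integral_eq_lintegral_ofReal (integrable_mul_div_add hf h0 hn)
      (h0.mono fun x hx => by simp only [Pi.zero_apply]; positivity)]
    exact ENNReal.ofReal_le_ofReal (hbound _ hn)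

/-- The quantity equals the mean of `z f / (f + z)` divided by `z ∫ (f + z)⁻¹ dP`; the numerator
converges by domination by `f`, and the denominator tends to `1`. -/
lemma tendsto_harmonic [IsProbabilityMeasure P] (hf : Integrable f P) (h0 : ∀ᵐ x ∂P, 0 ≤ f x) :
    Tendsto (fun z => 1 / (∫ x, (f x + z)⁻¹ ∂P) - z) atTop (𝓝 (∫ x, f x ∂P)) := by
  have h1 : Tendsto (fun z => ∫ x, z * f x / (f x + z) ∂P) atTop (𝓝 (∫ x, f x ∂P)) := by
    refine tendsto_integral_filter_of_dominated_convergence f ?_ ?_ hf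
      (Eventually.of_forall fun x => tendsto_mul_div_add (f x))
    · filter_upwards [eventually_gt_atTop 0] with z hz
      exact (integrable_mul_div_add hf.aemeasurable h0 hz).aestronglyMeasurable
    · filter_upwards [eventually_gt_atTop 0] with z hz
      filter_upwards [h0] with x hx
      rw [Real.norm_of_nonneg (by positivity), div_le_iff₀ (by positivity)]
      nlinarith [mul_nonneg hx hx]
  have h2 : Tendsto (fun z => z * ∫ x, (f x + z)⁻¹ ∂P) atTop (𝓝 1) := by
    have := ((tendsto_inv_atTop_zero (𝕜 := ℝ)).mul h1).const_sub 1
    rw [zero_mul, sub_zero] at this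
    refine this.congr' ?_
    filter_upwards [eventually_gt_atTop 0] with z hz
    rw [integral_mul_div_add hf.aemeasurable h0 hz]
    field_simp
    ring
  have h3 := h1.div h2 one_ne_zero
  rw [div_one] at h3
  refine h3.congr' ?_
  filter_upwards [eventually_gt_atTop 0] with z hz
  have hI := integral_inv_add_pos hf.aemeasurable h0 hz
  simp only [Pi.div_apply]
  rw [integral_mul_div_add hf.aemeasurable h0 hz]
  set I := ∫ x, (f x + z)⁻¹ ∂P
  field_simp

/-- The equality case of the inequality between harmonic and arithmetic means. -/
lemma ae_eq_const_of_harmonic_eq [IsProbabilityMeasure P]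
    (hf : Integrable f P) (h0 : ∀ᵐ x ∂P, 0 ≤ f x) {z : ℝ}
    (hz : 0 < z) (heq : 1 / (∫ x, (f x + z)⁻¹ ∂P) - z = ∫ x, f x ∂P) :
    ∀ᵐ x ∂P, f x = ∫ x, f x ∂P := by
  have hI := integral_inv_add_pos hf.aemeasurable h0 hz
  have hi := integrable_inv_add_const hf.aemeasurable h0 hz
  have hA : 0 ≤ ∫ x, f x ∂P := integral_nonneg_of_ae h0
  set A := ∫ x, f x ∂P
  have hAz : 0 < A + z := by positivity
  have hI1 : (A + z) * ∫ x, (f x + z)⁻¹ ∂P = 1 := by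
    rw [← heq, sub_add_cancel]
    exact one_div_mul_cancel hI.ne'
  -- This is `r + 1/r - 2 ≥ 0` for `r = (f + z) / (A + z)`; under the equality hypothesis its mean
  -- vanishes.
  have hsq : (fun x => (f x + z) * (A + z)⁻¹ + (A + z) * (f x + z)⁻¹ - 2) =ᵐ[P]
      fun x => (f x - A) ^ 2 / ((A + z) * (f x + z)) := by
    filter_upwards [h0] with x hx
    have : 0 < f x + z := by positivity
    field_simp
    ring
  have hj1 : Integrable (fun x => (f x + z) * (A + z)⁻¹) P :=
    (hf.add (integrable_const z)).mul_const _
  have hj2 : Integrable (fun x => (A + z) * (f x + z)⁻¹) P := hi.const_mul _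
  have hj : Integrable (fun x => (f x + z) * (A + z)⁻¹ + (A + z) * (f x + z)⁻¹ - 2) P :=
    (hj1.add hj2).sub (integrable_const 2)
  have hz0 : ∫ x, (f x - A) ^ 2 / ((A + z) * (f x + z)) ∂P = 0 := by
    have e1 := integral_sub (hj1.add hj2) (integrable_const (2 : ℝ))
    simp only [Pi.add_apply] at e1
    rw [← integral_congr_ae hsq, e1, integral_add hj1 hj2, integral_mul_const,
      integral_add hf (integrable_const z), integral_const_mul, hI1]
    simp only [integral_const, probReal_univ, smul_eq_mul, one_mul]
    rw [mul_inv_cancel₀ hAz.ne']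
    norm_num
  have hnn : 0 ≤ᵐ[P] fun x => (f x - A) ^ 2 / ((A + z) * (f x + z)) := by
    filter_upwards [h0] with x hx
    simp only [Pi.zero_apply]
    positivity
  have := (integral_eq_zero_iff_of_nonneg_ae hnn (hj.congr hsq)).1 hz0
  filter_upwards [this, h0] with x hx hx0
  have hx1 : 0 < f x + z := by positivity
  simp only [Pi.zero_apply, div_eq_zero_iff] at hx
  rcases hx with hx | hx
  · linarith [pow_eq_zero_iff (two_ne_zero) |>.1 hx]
  · exact absurd hx (by positivity)

end HarmonicMean

/-! ### Consequences of a finite representing measure. -/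

section Representation

variable {Ω : Type*} [MeasurableSpace Ω] {P : Measure Ω}
  {a : Ω → ℝ} {ρ : Measure ℝ}

lemma ae_restrict_Ioi_pos : ∀ᵐ t ∂ρ.restrict (Ioi 0), 0 < t :=
  ae_restrict_mem measurableSet_Ioi

/-- Below `1` the defining integrability condition dominates `1/t`; above `1` finiteness of the
measure does. -/
lemma integrable_inv_of_representing (hρ : IsRepresentingMeasure P a ρ)
    [IsFiniteMeasure (ρ.restrict (Ioi 0))] : Integrable (fun t => t⁻¹) (ρ.restrict (Ioi 0)) := by
  refine Integrable.mono' ((hρ.1.const_mul 2).add (integrable_const 1))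
    measurable_inv.aestronglyMeasurable ?_
  filter_upwards [ae_restrict_Ioi_pos] with t ht
  rw [Real.norm_of_nonneg (by positivity)]
  simp only [Pi.add_apply]
  rcases le_total t 1 with h | h
  · have : t⁻¹ ≤ 2 * (1 / (t * (t + 1))) := by
      rw [inv_eq_one_div, mul_one_div, div_le_div_iff₀ ht (by positivity)]
      nlinarith
    linarith
  · have h1 : t⁻¹ ≤ 1 := inv_le_one_of_one_le₀ h
    have h2 : 0 ≤ 2 * (1 / (t * (t + 1))) := by positivity
    linarith

lemma harmonic_eq_const_sub_stieltjes (hρ : IsRepresentingMeasure P a ρ)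
    [IsFiniteMeasure (ρ.restrict (Ioi 0))] :
    ∃ K : ℝ, ∀ z, 0 < z → 1 / (∫ x, (a x - xi P a + z)⁻¹ ∂P) - z =
      K - stieltjes (ρ.restrict (Ioi 0)) z := by
  refine ⟨((H P a)⁻¹).toReal + ∫ t in Ioi (0 : ℝ), t⁻¹ ∂ρ, fun z hz => ?_⟩
  have h := hρ.2 (z - xi P a) (by linarith)
  have h1 : ∫ t in Ioi (0 : ℝ), (z - xi P a + xi P a) / (t * (t + (z - xi P a) + xi P a)) ∂ρ =
      ∫ t in Ioi (0 : ℝ), (t⁻¹ - (t + z)⁻¹) ∂ρ := by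
    refine integral_congr_ae ?_
    filter_upwards [ae_restrict_Ioi_pos] with t ht
    rw [sub_add_cancel, show t + (z - xi P a) + xi P a = t + z by ring]
    field_simp
    ring
  rw [h1, integral_sub (integrable_inv_of_representing hρ)
    (integrable_inv_add ae_restrict_Ioi_pos hz)] at h
  have h2 : ∀ x, a x + (z - xi P a) = a x - xi P a + z := fun x => by ring
  simp only [Psi, h2] at h
  unfold stieltjes
  linarith

/-- The shifted harmonic mean is a constant minus `S`, hence bounded above, which gives
integrability. Letting `z → ∞` identifies the constant as `E - ξ`. -/
theorem integrable_of_representing [IsProbabilityMeasure P] (ha : AEMeasurable a P)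
    (hbdd : ∃ B : ℝ, ∀ᵐ x ∂P, B ≤ a x) (hρ : IsRepresentingMeasure P a ρ)
    [IsFiniteMeasure (ρ.restrict (Ioi 0))] :
    Integrable a P ∧ ∀ z, 0 < z → 1 / (∫ x, (a x + (z - xi P a))⁻¹ ∂P) =
      z - xi P a + ∫ x, a x ∂P - stieltjes (ρ.restrict (Ioi 0)) z := by
  obtain ⟨K, hK⟩ := harmonic_eq_const_sub_stieltjes hρ
  have hmeas : AEMeasurable (fun x => a x - xi P a) P := ha.sub_const _
  have h0 : ∀ᵐ x ∂P, 0 ≤ a x - xi P a := (xi_le hbdd).mono fun x hx => by linarith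
  have hint : Integrable (fun x => a x - xi P a) P := by
    refine integrable_of_harmonic_bounded hmeas h0 (K := K) fun z hz => ?_
    rw [hK z hz]
    have : 0 ≤ stieltjes (ρ.restrict (Ioi 0)) z :=
      integral_nonneg_of_ae (ae_restrict_Ioi_pos.mono fun t ht => by
        simp only [Pi.zero_apply]; positivity)
    linarith
  have hinta : Integrable a P :=
    (hint.add (integrable_const (xi P a))).congr (Eventually.of_forall fun x => by simp)
  refine ⟨hinta, fun z hz => ?_⟩
  have hlim : Tendsto (fun z => 1 / (∫ x, (a x - xi P a + z)⁻¹ ∂P) - z) atTop (𝓝 K) := by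
    have := (tendsto_stieltjes_zero (ν := ρ.restrict (Ioi 0)) ae_restrict_Ioi_pos).const_sub K
    rw [sub_zero] at this
    refine this.congr' ?_
    filter_upwards [eventually_gt_atTop 0] with z hz
    rw [hK z hz]
  have hKA := tendsto_nhds_unique hlim (tendsto_harmonic hint h0)
  rw [integral_sub hinta (integrable_const _)] at hKA
  simp only [integral_const, probReal_univ, smul_eq_mul, one_mul] at hKA
  have h2 : ∀ x, a x + (z - xi P a) = a x - xi P a + z := fun x => by ring
  simp only [h2]
  have := hK z hz
  linarith

/-- If the measure vanished, harmonic and arithmetic means of `a - ξ + 1` would coincide, forcing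
`a` to be constant. -/
lemma restrict_ne_zero_of_representing [IsProbabilityMeasure P] (ha : AEMeasurable a P)
    (hbdd : ∃ B : ℝ, ∀ᵐ x ∂P, B ≤ a x) (hnc : ¬ ∃ k : ℝ, ∀ᵐ x ∂P, a x = k)
    (hρ : IsRepresentingMeasure P a ρ) [IsFiniteMeasure (ρ.restrict (Ioi 0))] :
    ρ.restrict (Ioi 0) ≠ 0 := by
  intro hzero
  obtain ⟨hint, hrep⟩ := integrable_of_representing ha hbdd hρ
  have h0 : ∀ᵐ x ∂P, 0 ≤ a x - xi P a := (xi_le hbdd).mono fun x hx => by linarith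
  have hint' : Integrable (fun x => a x - xi P a) P := hint.sub (integrable_const _)
  have hA : ∫ x, (a x - xi P a) ∂P = ∫ x, a x ∂P - xi P a := by
    rw [integral_sub hint (integrable_const _)]
    simp
  have h := hrep 1 one_pos
  have h2 : ∀ x, a x + (1 - xi P a) = a x - xi P a + 1 := fun x => by ring
  simp only [h2, hzero, stieltjes, integral_zero_measure] at h
  have hc := ae_eq_const_of_harmonic_eq hint' h0 one_pos (by rw [hA, h]; ring)
  rw [hA] at hc
  exact hnc ⟨∫ x, a x ∂P, hc.mono fun x hx => by linarith⟩

lemma xi_lt_integral [IsProbabilityMeasure P]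
    (hint : Integrable a P) (hbdd : ∃ B : ℝ, ∀ᵐ x ∂P, B ≤ a x)
    (hnc : ¬ ∃ k : ℝ, ∀ᵐ x ∂P, a x = k) : xi P a < ∫ x, a x ∂P := by
  have h0 : 0 ≤ᵐ[P] fun x => a x - xi P a := (xi_le hbdd).mono fun x hx => by
    simp only [Pi.zero_apply]; linarith
  have hint' : Integrable (fun x => a x - xi P a) P := hint.sub (integrable_const _)
  have hA : ∫ x, (a x - xi P a) ∂P = ∫ x, a x ∂P - xi P a := by
    rw [integral_sub hint (integrable_const _)]
    simp
  have hnn := integral_nonneg_of_ae h0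
  rw [hA] at hnn
  refine lt_of_le_of_ne (by linarith) fun heq => hnc ⟨xi P a, ?_⟩
  have := (integral_eq_zero_iff_of_nonneg_ae h0 hint').1 (by rw [hA, heq, sub_self])
  filter_upwards [this] with x hx
  simp only [Pi.zero_apply] at hx
  linarith

end Representation

/-! ### The translated game and its maximal proportion. -/

section Translated

variable {Ω : Type*} [MeasurableSpace Ω] {P : Measure Ω}

/-- Between two distinct candidates the unique optimal proportion would be both strictly decreasing
and strictly increasing. -/
lemma IsMaxPrice.unique {b : Ω → ℝ} (huniq : ∀ u : ℝ, 0 < u → (u : EReal) < mean P b →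
    ∀ t t', IsOptimalProportion P b u t → IsOptimalProportion P b u t' → t = t') {v v' : ℝ}
    (hv : IsMaxPrice P b v) (hv' : IsMaxPrice P b v') : v = v' := by
  wlog hlt : v < v' generalizing v v'
  · rcases (not_lt.1 hlt).eq_or_lt with h | h
    · exact h.symm
    · exact (this hv' hv h).symm
  exfalso
  obtain ⟨h0, -, t, ht, -, hanti, -⟩ := hv
  obtain ⟨-, h1', t', ht', hmono', -, -⟩ := hv'
  have hmean : ∀ u, u < v' → (u : EReal) < mean P b := fun u hu =>
    (EReal.coe_lt_coe_iff.2 hu).trans h1'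
  obtain ⟨x, hx1, hx2⟩ := exists_between hlt
  obtain ⟨y, hy1, hy2⟩ := exists_between hx2
  have hx0 := h0.trans hx1
  have hy0 := hx0.trans hy1
  have e1 := huniq x hx0 (hmean x hx2) _ _ (ht x hx0 (hmean x hx2)) (ht' x hx0 (hmean x hx2))
  have e2 := huniq y hy0 (hmean y hy2) _ _ (ht y hy0 (hmean y hy2)) (ht' y hy0 (hmean y hy2))
  have h1 := hanti ⟨hx1, hmean x hx2⟩ ⟨hx1.trans hy1, hmean y hy2⟩ hy1
  have h2 := hmono' ⟨hx0, hx2⟩ ⟨hy0, hy2⟩ hy1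
  rw [e1, e2] at h1
  exact h1.not_gt h2

lemma div_add_lt_iff {u c u' c' : ℝ} (hu : 0 < u) (hc : 0 < c) (hu' : 0 < u') (hc' : 0 < c') :
    u / (u + c) < u' / (u' + c') ↔ u / c < u' / c' := by
  rw [div_lt_div_iff₀ (by positivity) (by positivity), div_lt_div_iff₀ hc hc']
  constructor <;> intro h <;> linarith

/-- A game with mean `e` whose optimal proportion at the price `e - S y`, where `S` is a
Stieltjes transform, is `u / (u + y + k)`. -/
lemma isMaxPrice_of_stieltjes {b : Ω → ℝ} {ν : Measure ℝ} [IsFiniteMeasure ν]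
    (hν : ∀ᵐ t ∂ν, 0 < t) (hν0 : ν ≠ 0) {e k x : ℝ} (hk : 0 < k)
    (he1 : e < stieltjes ν 1) (hmean : mean P b = (e : EReal))
    (hopt : ∀ y, 0 < y → 0 < e - stieltjes ν y → ∀ t,
      IsOptimalProportion P b (e - stieltjes ν y) t ↔
        t = (e - stieltjes ν y) / (e - stieltjes ν y + (y + k)))
    (hx0 : 0 < x) (hx : stieltjes ν x + (x + k) * stieltjesDiff ν x x = e) :
    IsMaxPrice P b (e - stieltjes ν x) := by
  -- Since `S` decreases continuously to `0` and `e < S(1)`, every price in `(0, e)` is attained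
  -- with `y > 1`.
  have hinv : ∀ u, 0 < u → u < e → ∃ y, 0 < y ∧ u = e - stieltjes ν y := by
    intro u hu hue
    obtain ⟨y, hy, hyu⟩ := exists_stieltjes_eq hν (w := e - u) (by linarith) (by linarith)
    exact ⟨y, zero_lt_one.trans hy, by linarith⟩
  have hex : ∀ u, ∃ t, 0 < u → u < e → IsOptimalProportion P b u t := by
    intro u
    by_cases h : 0 < u ∧ u < e
    · obtain ⟨y, hy, rfl⟩ := hinv u h.1 h.2
      exact ⟨_, fun _ _ => (hopt y hy h.1 _).2 rfl⟩
    · exact ⟨0, fun h1 h2 => absurd ⟨h1, h2⟩ h⟩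
  choose t ht using hex
  have hpos : ∀ y, 0 < y → e - stieltjes ν y < e := fun y hy => by
    linarith [stieltjes_pos hν hν0 hy]
  have htval : ∀ y, 0 < y → 0 < e - stieltjes ν y → t (e - stieltjes ν y) =
      (e - stieltjes ν y) / (e - stieltjes ν y + (y + k)) := fun y hy hu =>
    (hopt y hy hu _).1 (ht _ hu (hpos y hy))
  have hlt : ∀ y z, 0 < y → 0 < z → 0 < e - stieltjes ν y → 0 < e - stieltjes ν z →
      (e - stieltjes ν y) / (y + k) < (e - stieltjes ν z) / (z + k) →
      t (e - stieltjes ν y) < t (e - stieltjes ν z) := by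
    intro y z hy hz huy huz h
    rw [htval y hy huy, htval z hz huz]
    exact (div_add_lt_iff huy (by positivity) huz (by positivity)).2 h
  have hord : ∀ y z, 0 < y → 0 < z → e - stieltjes ν y < e - stieltjes ν z → y < z := by
    intro y z hy hz h
    exact ((stieltjes_strictAnti hν hν0).lt_iff_gt hz hy).1 (by linarith)
  have hv0 : 0 < e - stieltjes ν x := by
    have := stieltjesDiff_pos hν hν0 hx0 hx0
    have : 0 < (x + k) * stieltjesDiff ν x x := by positivity
    linarith
  have hmono := strictMonoOn_ratio hν hν0 hk hx
  have hanti := strictAntiOn_ratio hν hν0 hk hx0 hx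
  rw [IsMaxPrice, hmean]
  simp only [EReal.coe_lt_coe_iff]
  refine ⟨hv0, hpos x hx0, t, fun u hu hue => ht u hu hue, ?_, ?_, ?_⟩
  · intro u hu u' hu' huu'
    obtain ⟨y, hy, rfl⟩ := hinv u hu.1 (hu.2.trans (hpos x hx0))
    obtain ⟨z, hz, rfl⟩ := hinv u' hu'.1 (hu'.2.trans (hpos x hx0))
    exact hlt y z hy hz hu.1 hu'.1 (hmono ⟨hy, (hord y x hy hx0 hu.2).le⟩
      ⟨hz, (hord z x hz hx0 hu'.2).le⟩ (hord y z hy hz huu'))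
  · intro u hu u' hu' huu'
    obtain ⟨y, hy, rfl⟩ := hinv u (hv0.trans hu.1) hu.2
    obtain ⟨z, hz, rfl⟩ := hinv u' (hv0.trans hu'.1) hu'.2
    exact hlt z y hz hy (hv0.trans hu'.1) (hv0.trans hu.1) (hanti (hord x y hx0 hy hu.1).le
      (hord x z hx0 hz hu'.1).le (hord y z hy hz huu'))
  · intro u hu hue
    obtain ⟨y, hy, rfl⟩ := hinv u hu hue
    rcases lt_trichotomy y x with h | rfl | h
    · exact (hlt y x hy hx0 hu hv0 (hmono ⟨hy, h.le⟩ ⟨hx0, le_rfl⟩ h)).le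
    · exact le_rfl
    · exact (hlt y x hy hx0 hu hv0 (hanti self_mem_Ici h.le h)).le

lemma tendsto_critical_ratio {ν : Measure ℝ} [IsFiniteMeasure ν] (hν : ∀ᵐ t ∂ν, 0 < t)
    (hν0 : ν ≠ 0) {ι : Type*} {l : Filter ι} {e k y : ι → ℝ} {d : ℝ} (he : Tendsto e l (𝓝 0))
    (hk : Tendsto k l (𝓝 d)) (hkpos : ∀ᶠ m in l, 0 < k m) (hy : ∀ᶠ m in l, 0 < y m ∧
      stieltjes ν (y m) + (y m + k m) * stieltjesDiff ν (y m) (y m) = e m) :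
    Tendsto (fun m => (e m - stieltjes ν (y m)) / e m) l (𝓝 (1 / 2)) := by
  have hR : 0 < ν.real univ := by
    have : NeZero ν := ⟨hν0⟩
    exact measureReal_univ_pos
  have hyt : Tendsto y l atTop := by
    refine tendsto_atTop.2 fun M => ?_
    -- Strict monotonicity of `S` is available only on positive arguments.
    have hM : (0 : ℝ) < max M 1 := lt_max_of_lt_right one_pos
    filter_upwards [hy, hkpos, he.eventually_lt_const (stieltjes_pos hν hν0 hM)]
      with m hm hkm hem
    have h1 := stieltjesDiff_pos hν hν0 hm.1 hm.1
    have h2 : 0 < (y m + k m) * stieltjesDiff ν (y m) (y m) := mul_pos (by linarith [hm.1]) h1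
    have h3 : stieltjes ν (y m) < stieltjes ν (max M 1) := by linarith [hm.2]
    exact (le_max_left M 1).trans
      (((stieltjes_strictAnti hν hν0).lt_iff_gt hm.1 hM).1 h3).le
  have h1 := (tendsto_mul_stieltjes hν).comp hyt
  have h2 := (tendsto_sq_mul_stieltjesDiff hν).comp hyt
  -- `y (y + k) T = (1 + k/y) · y² T`, and `k` stays bounded as it converges to `d`.
  have h3 := (hk.mul (tendsto_inv_atTop_zero.comp hyt)).const_add 1
  rw [mul_zero, add_zero] at h3
  have h4 := h3.mul h2
  rw [one_mul] at h4
  have h5 := h4.div (h1.add h4) (by positivity)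
  have h6 : ν.real univ / (ν.real univ + ν.real univ) = 1 / 2 := by
    field_simp
    norm_num
  rw [h6] at h5
  refine h5.congr' ?_
  filter_upwards [hy, hkpos] with m hm hkm
  have hy0 := hm.1
  have hT := stieltjesDiff_pos hν hν0 hm.1 hm.1
  have hS := stieltjes_pos hν hν0 hm.1
  simp only [Pi.div_apply, Function.comp_apply]
  rw [← hm.2, add_sub_cancel_left]
  rw [div_eq_div_iff (by positivity) (by positivity)]
  field_simp

/-- With `c = y + m - ξ`, the representation says exactly that `u + c` is the reciprocal of `∫ (a -
m + c)⁻¹ dP`, which is the first order condition. -/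
lemma optimal_translated [IsProbabilityMeasure P]
    {a : Ω → ℝ} {ν : Measure ℝ} (hint : Integrable a P)
    (hbdd : ∃ B : ℝ, ∀ᵐ x ∂P, B ≤ a x) (hnc : ¬ ∃ k : ℝ, ∀ᵐ x ∂P, a x = k)
    (hrep : ∀ z, 0 < z → 1 / (∫ x, (a x + (z - xi P a))⁻¹ ∂P) =
      z - xi P a + ∫ x, a x ∂P - stieltjes ν z)
    {m : ℝ} (hm : xi P a < m) {y : ℝ} (hy : 0 < y)
    (hu : 0 < ∫ x, a x ∂P - m - stieltjes ν y) (t : ℝ) :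
    IsOptimalProportion P (fun x => a x - m) (∫ x, a x ∂P - m - stieltjes ν y) t ↔
      t = (∫ x, a x ∂P - m - stieltjes ν y) /
        (∫ x, a x ∂P - m - stieltjes ν y + (y + (m - xi P a))) := by
  have hxi := xi_sub hbdd m
  have hint' : Integrable (fun x => a x - m) P := hint.sub (integrable_const m)
  refine isOptimalProportion_iff hint' ?_ ?_ ?_ hu ?_ ?_
  · rw [hxi]
    filter_upwards [xi_le hbdd] with x hx
    linarith
  · rintro ⟨k, hk⟩
    exact hnc ⟨k + m, hk.mono fun x hx => by linarith⟩
  · rw [hxi]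
    linarith
  · rw [hxi]
    linarith
  · have h2 : ∀ x, a x - m + (y + (m - xi P a)) = a x + (y - xi P a) := fun x => by ring
    simp only [h2]
    have h := hrep y hy
    set I := ∫ x, (a x + (y - xi P a))⁻¹ ∂P
    have h3 : ∫ x, a x ∂P - m - stieltjes ν y + (y + (m - xi P a)) = 1 / I := by
      rw [h]
      ring
    have h4 : 0 < 1 / I := by
      rw [← h3]
      linarith
    rw [h3]
    exact one_div_mul_cancel (one_div_pos.1 h4).ne'

end Translated

end InvestmentGame

end

theorem theorem3p19 {Ω : Type*} [MeasurableSpace Ω] (P : Measure Ω) [IsProbabilityMeasure P]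
    (a : Ω → ℝ) (ha : AEMeasurable a P)
    (hbdd : ∃ B : ℝ, ∀ᵐ x ∂P, B ≤ a x)
    (hnonconst : ¬ ∃ k : ℝ, ∀ᵐ x ∂P, a x = k)
    (ρ : Measure ℝ) (hρ : InvestmentGame.IsRepresentingMeasure P a ρ)
    (hfin : ρ (Ioi 0) < ⊤) :
    ∃ E : ℝ, InvestmentGame.mean P a = (E : EReal) ∧
      (∀ᶠ m in 𝓝[<] E,
        (∀ u ∈ Ioo (0 : ℝ) (E - m),
          ∃! t : ℝ, InvestmentGame.IsOptimalProportion P (fun x => a x - m) u t) ∧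
        ∃! v : ℝ, InvestmentGame.IsMaxPrice P (fun x => a x - m) v) ∧
      ∀ umax : ℝ → ℝ,
        (∀ᶠ m in 𝓝[<] E, InvestmentGame.IsMaxPrice P (fun x => a x - m) (umax m)) →
        Tendsto (fun m : ℝ => umax m / (E - m)) (𝓝[<] E) (𝓝 (1 / 2)) := by
  open InvestmentGame in
  have : IsFiniteMeasure (ρ.restrict (Ioi 0)) := ⟨by rwa [Measure.restrict_apply_univ]⟩
  obtain ⟨hint, hrep⟩ := integrable_of_representing ha hbdd hρ
  have hν0 := restrict_ne_zero_of_representing ha hbdd hnonconst hρ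
  have hν : ∀ᵐ t ∂ρ.restrict (Ioi 0), 0 < t := ae_restrict_Ioi_pos
  have hxi := xi_lt_integral hint hbdd hnonconst
  have hopt := fun m hm y => optimal_translated hint hbdd hnonconst hrep (m := m) hm (y := y)
  set ν := ρ.restrict (Ioi 0)
  set E := ∫ x, a x ∂P with hE
  have hmean : ∀ m, mean P (fun x => a x - m) = ((E - m : ℝ) : EReal) := by
    intro m
    have hint' : Integrable (fun x => a x - m) P := hint.sub (integrable_const m)
    rw [mean, extIntegral_eq_integral hint',
      integral_sub hint (integrable_const m)]
    simp [hE]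
  -- `ξ < m` makes the essential infimum of the translated game negative; `E - m < S(1)` lets every
  -- price be written as `E - m - S(y)`.
  have hnear : ∀ᶠ m in 𝓝[<] E, xi P a < m ∧ m < E ∧ E - m < stieltjes ν 1 := by
    have hS := stieltjes_pos hν hν0 one_pos
    filter_upwards [self_mem_nhdsWithin, mem_nhdsWithin_of_mem_nhds (lt_mem_nhds hxi),
      mem_nhdsWithin_of_mem_nhds (lt_mem_nhds (sub_lt_self E hS))] with m h1 h2 h3
    exact ⟨h2, h1, by linarith⟩
  have huniq : ∀ m, xi P a < m → m < E → E - m < stieltjes ν 1 → ∀ u ∈ Ioo (0 : ℝ) (E - m),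
      ∃! t : ℝ, IsOptimalProportion P (fun x => a x - m) u t := by
    intro m hm1 hm2 hm3 u hu
    obtain ⟨y, hy, hyu⟩ := exists_stieltjes_eq hν (w := E - m - u) (by linarith [hu.2])
      (by linarith [hu.1])
    obtain rfl : u = E - m - stieltjes ν y := by linarith
    have h := hopt m hm1 y (zero_lt_one.trans hy) hu.1
    exact ⟨_, (h _).2 rfl, fun t ht => (h t).1 ht⟩
  have hmax : ∀ m, xi P a < m → m < E → E - m < stieltjes ν 1 → ∃ y, (0 < y ∧
      stieltjes ν y + (y + (m - xi P a)) * stieltjesDiff ν y y = E - m) ∧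
      ∀ v, IsMaxPrice P (fun x => a x - m) v ↔ v = E - m - stieltjes ν y := by
    intro m hm1 hm2 hm3
    obtain ⟨y, hy, hye⟩ := exists_critical hν hν0 (sub_pos.2 hm2) hm3 (sub_pos.2 hm1)
    have hv := isMaxPrice_of_stieltjes hν hν0 (sub_pos.2 hm1) hm3 (hmean m) (hopt m hm1) hy hye
    refine ⟨y, ⟨hy, hye⟩, fun v => ⟨fun h => ?_, fun h => h ▸ hv⟩⟩
    refine IsMaxPrice.unique (fun u hu hum t t' ht ht' => ?_) h hv
    rw [hmean, EReal.coe_lt_coe_iff] at hum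
    exact (huniq m hm1 hm2 hm3 u ⟨hu, hum⟩).unique ht ht'
  refine ⟨E, by simpa using hmean 0, ?_, fun umax humax => ?_⟩
  · filter_upwards [hnear] with m ⟨hm1, hm2, hm3⟩
    obtain ⟨y, -, hy⟩ := hmax m hm1 hm2 hm3
    exact ⟨huniq m hm1 hm2 hm3, _, (hy _).2 rfl, fun v hv => (hy v).1 hv⟩
  · have hex : ∀ m, ∃ y, xi P a < m → m < E → E - m < stieltjes ν 1 → (0 < y ∧
        stieltjes ν y + (y + (m - xi P a)) * stieltjesDiff ν y y = E - m) ∧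
        ∀ v, IsMaxPrice P (fun x => a x - m) v ↔ v = E - m - stieltjes ν y := by
      intro m
      by_cases h : xi P a < m ∧ m < E ∧ E - m < stieltjes ν 1
      · obtain ⟨y, hy⟩ := hmax m h.1 h.2.1 h.2.2
        exact ⟨y, fun _ _ _ => hy⟩
      · exact ⟨0, fun h1 h2 h3 => absurd ⟨h1, h2, h3⟩ h⟩
    choose y hy using hex
    have hid : Tendsto (fun m : ℝ => m) (𝓝[<] E) (𝓝 E) := tendsto_id.mono_left nhdsWithin_le_nhds
    have he : Tendsto (fun m => E - m) (𝓝[<] E) (𝓝 0) := by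
      simpa using hid.const_sub E
    refine (tendsto_critical_ratio hν hν0 he (hid.sub_const (xi P a))
      (hnear.mono fun m hm => sub_pos.2 hm.1)
      (hnear.mono fun m hm => (hy m hm.1 hm.2.1 hm.2.2).1)).congr' ?_
    filter_upwards [hnear, humax] with m ⟨hm1, hm2, hm3⟩ hv
    rw [((hy m hm1 hm2 hm3).2 _).1 hv]
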